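/- For integers $d\ge 1$ and $n\ge 0$, a $d$-multipermutation of size $n$ is a $d$-tuple $(\sigma_1,\dots,\sigma_d)$ of permutations of $[n]=\{1,\dots,n\}$. It is a $d$-constellation if the group $\langle\sigma_1,\dots,\sigma_d\rangle$ acts transitively on $[n]$ and $\sigma_1\cdots\sigma_d=\mathrm{id}$; let $c_n(d)$ be the number of $d$-constellations of size $n$. A $d$-multipermutation of size $n$ is indecomposable if there is no $k$ with $0<k<n$ such that $\sigma_i([k])=[k]$ for all $i$; let $\mathfrak{imp}_n(d)$ be the number of indecomposable $d$-multipermutations of size $n$. A $d$-tuple $(<_1,\dots,<_d)$ of linear orders on $[n]$ is irreducible if there is no partition $[n]=A\sqcup B$ into two nonempty parts such that $a<_i b$ for all $a\in A$, $b\in B$ and all $i$; let $\mathfrak{il}_n(d)$ be the number of irreducible $d$-tuples of linear orders on $[n]$. Write $(n)_k=n(n-1)\cdots(n-k+1)$. For a sequence $(a_n)$ and functions $f_0,f_1,\dots$, write $a_n\approx\sum_{k\ge0}f_k(n)$ if, as $n\to\infty$, $a_n=\sum_{k=0}^{r}f_k(n)+O(f_{r+1}(n))$ for every $r\ge0$ and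 $f_{k+1}(n)=o(f_k(n))$ for every $k\ge0$. Let $d\ge3$. Then, as $n\to\infty$, $$c_n(d)\approx (n!)^{d-1}\Bigl(1-\sum_{k\ge1}\frac{\mathfrak{imp}_k(d-2)}{\bigl((n)_k\bigr)^{d-2}}\Bigr)$$ and $$c_n(d)\approx (n!)^{d-1}\Bigl(1-\sum_{k\ge1}\frac{\mathfrak{il}_k(d-1)}{k!\,\bigl((n)_k\bigr)^{d-2}}\Bigr),$$ where the right-hand sides are read term by term: $f_0(n)=(n!)^{d-1}$, and for $k\ge1$ the function $f_k(n)$ is $-(n!)^{d-1}$ times the $k$-th summand. -/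

import Mathlib

open Filter Asymptotics

namespace Constellation

/-- `HasAsymptoticExpansion a m f` is `a n ≈ ∑_{k ≥ m} f k n` as `n → ∞`: for every `r ≥ m`,
`a n = ∑_{k=m}^{r} f k n + O(f (r+1) n)`, and `f (k+1) n = o(f k n)` for every `k ≥ m`. -/
def HasAsymptoticExpansion (a : ℕ → ℝ) (m : ℕ) (f : ℕ → ℕ → ℝ) : Prop :=
  (∀ r ≥ m, (fun n => a n - ∑ k ∈ Finset.Icc m r, f k n) =O[atTop] (f (r + 1))) ∧
    ∀ k ≥ m, (f (k + 1)) =o[atTop] (f k)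

/-- A `d`-multipermutation of size `n`: a `d`-tuple of permutations of an `n`-element ordered
set, here `Fin n`. -/
abbrev Multiperm (d n : ℕ) : Type := Fin d → Equiv.Perm (Fin n)

/-- A `d`-constellation of size `n`: the group generated by `σ₁, …, σ_d` acts transitively, and
`σ₁ ⋯ σ_d = id`. -/
structure IsConstellation {d n : ℕ} (σ : Multiperm d n) : Prop where
  transitive : MulAction.IsPretransitive (Subgroup.closure (Set.range σ)) (Fin n)
  prod_eq_one : (List.ofFn σ).prod = 1

/-- The number `c_n(d)` of `d`-constellations of size `n`. -/
noncomputable def numConstellations (d n : ℕ) : ℕ :=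
  Nat.card {σ : Multiperm d n // IsConstellation σ}

/-- The initial segment `[k]` of the ground set, that is, its `k` smallest elements. -/
def initialSegment (n k : ℕ) : Set (Fin n) := {x | (x : ℕ) < k}

/-- A multipermutation of size `n` is indecomposable if no `[k]` with `0 < k < n` is stable under
all the `σ i`. -/
def IsIndecomposable {d n : ℕ} (σ : Multiperm d n) : Prop :=
  ¬ ∃ k : ℕ, 0 < k ∧ k < n ∧ ∀ i, σ i '' initialSegment n k = initialSegment n k

/-- The number `imp_n(d)` of indecomposable `d`-multipermutations of size `n`. -/
noncomputable def imp (d n : ℕ) : ℕ :=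
  Nat.card {σ : Multiperm d n // IsIndecomposable σ}

/-- A `d`-multiple linear order of size `n`: a `d`-tuple of linear orders of `Fin n`. -/
abbrev MultiLinearOrder (d n : ℕ) : Type := Fin d → LinearOrder (Fin n)

/-- A multiple linear order is reducible if the ground set splits into two nonempty parts `A` and
`B` such that `a < b` in each of the orders, for all `a ∈ A` and `b ∈ B`. -/
def IsReducible {d n : ℕ} (L : MultiLinearOrder d n) : Prop :=
  ∃ A B : Set (Fin n), A.Nonempty ∧ B.Nonempty ∧ A ∪ B = Set.univ ∧ Disjoint A B ∧
    ∀ a ∈ A, ∀ b ∈ B, ∀ i, (L i).lt a b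

/-- The number `il_n(d)` of irreducible `d`-multiple linear orders of size `n`. -/
noncomputable def il (d n : ℕ) : ℕ :=
  Nat.card {L : MultiLinearOrder d n // ¬ IsReducible L}

/-- The terms obtained by expanding `(n!)^(d-1) (1 - ∑_{k ≥ 1} w k / ((n)_k)^(d-2))`: the term
of index `0` is `(n!)^(d-1)`, and the term of index `k ≥ 1` is
`-(n!)^(d-1) * w k / ((n)_k)^(d-2)`. -/
noncomputable def expansionTerm (d : ℕ) (w : ℕ → ℝ) (k n : ℕ) : ℝ :=
  if k = 0 then (n.factorial : ℝ) ^ (d - 1)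
  else -((n.factorial : ℝ) ^ (d - 1) * (w k / (n.descFactorial k : ℝ) ^ (d - 2)))

end Constellation

/-! Put `p = d - 2`, `f n = (n!)^p` and `F = ∑ f n x^n`. Dropping one permutation from a
constellation leaves a `(p+1)`-tuple generating a transitive group (`numConstellations_succ`). Since
`(n!)^(p+1) / n! = f n`, `F` is also the exponential generating function of all `(p+1)`-tuples;
marking a point and isolating its orbit gives `x F' = (x T') F` for the transitive ones
(`log_deriv_numTransitive`), that is, `T = log F`. Cutting a `p`-tuple at its first stable initial
segment gives `1 / F = 1 - ∑ imp_k x^k` (`sum_factPow_mul_invCoeff`).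

As `f` grows factorially, a convolution is dominated by its two ends. Hence `T = log F` has
coefficients `t n ≈ ∑ c k * f (n - k)`, where `c` are the coefficients of the derivative of `log` at
`F`, namely `1 / F` (`isBigO_sub_of_log_deriv`). Multiplying by `n!` gives the first expansion. The
second agrees with it term by term, because `il_k(p+1) = k! * imp_k(p)` (`il_succ_eq`). -/

namespace Constellation

/-! ### Asymptotics of the logarithm of a factorially divergent series -/

section Expansion

open Finset

/-- The sequence `(n!)^p`. -/
noncomputable def factPow (p n : ℕ) : ℝ := (n.factorial : ℝ) ^ p

lemma factPow_pos (p n : ℕ) : 0 < factPow p n := by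
  unfold factPow; positivity

lemma factPow_zero (p : ℕ) : factPow p 0 = 1 := by simp [factPow]

lemma factPow_succ (p n : ℕ) : factPow p (n + 1) = ((n : ℝ) + 1) ^ p * factPow p n := by
  simp [factPow, Nat.factorial_succ, mul_pow]

lemma mul_factPow_le {p : ℕ} (hp : 1 ≤ p) (n : ℕ) :
    ((n : ℝ) + 1) * factPow p n ≤ factPow p (n + 1) := by
  rw [factPow_succ]
  have h1 : (1 : ℝ) ≤ (n : ℝ) + 1 := by linarith [n.cast_nonneg (α := ℝ)]
  gcongr
  · exact (factPow_pos p n).le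
  · exact le_self_pow₀ h1 (by omega)

/-- Log-convexity of the factorial: for a fixed sum of indices, the product grows as the indices
move apart. -/
lemma factPow_mul_factPow_le (p s j l : ℕ) :
    factPow p (s + j) * factPow p (s + l) ≤ factPow p s * factPow p (s + j + l) := by
  have h : (s + j).factorial * (s + l).factorial ≤ s.factorial * (s + j + l).factorial := by
    rw [← Nat.factorial_mul_ascFactorial s j,
      show s + j + l = (s + l) + j by omega, ← Nat.factorial_mul_ascFactorial (s + l) j]
    have : (s + 1).ascFactorial j ≤ (s + l + 1).ascFactorial j := by
      induction j with
      | zero => simp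
      | succ j ih =>
        rw [Nat.ascFactorial_succ, Nat.ascFactorial_succ]
        exact Nat.mul_le_mul (by omega) ih
    calc s.factorial * (s + 1).ascFactorial j * (s + l).factorial
        = s.factorial * ((s + l).factorial * (s + 1).ascFactorial j) := by ring
      _ ≤ _ := by gcongr
  simp only [factPow, ← mul_pow]
  exact pow_le_pow_left₀ (by positivity) (by exact_mod_cast h) p

/-- The part of the convolution square of `(n!)^p` with both indices at least `s`. -/
lemma isBigO_sum_Ico_factPow {p : ℕ} (hp : 1 ≤ p) (s : ℕ) :
    (fun n => ∑ k ∈ Ico s (n + 1 - s), factPow p k * factPow p (n - k)) =O[atTop]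
      (fun n => factPow p (n - s)) := by
  refine IsBigO.of_bound (2 * factPow p s + 2 * factPow p (s + 1)) ?_
  filter_upwards [eventually_ge_atTop (2 * s + 2)] with n hn
  obtain ⟨m, rfl⟩ : ∃ m, n = 2 * s + 2 + m := ⟨n - (2 * s + 2), by omega⟩
  have hnn : ∀ k n, 0 ≤ factPow p k * factPow p n := fun k n =>
    (mul_pos (factPow_pos p k) (factPow_pos p n)).le
  rw [Real.norm_of_nonneg (sum_nonneg fun k _ => hnn _ _),
    Real.norm_of_nonneg (factPow_pos _ _).le,
    show 2 * s + 2 + m + 1 - s = (s + m + 2) + 1 by omega,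
    show 2 * s + 2 + m - s = s + m + 2 by omega,
    sum_Ico_succ_top (by omega), sum_eq_sum_Ico_succ_bot (by omega),
    show 2 * s + 2 + m - s = s + m + 2 by omega, show 2 * s + 2 + m - (s + m + 2) = s by omega]
  -- The two end terms already have the target size. By log-convexity each of the `m + 1` inner
  -- terms is one step smaller, and that step absorbs their number because `p ≥ 1`.
  have hmid : ∑ k ∈ Ico (s + 1) (s + m + 2), factPow p k * factPow p (2 * s + 2 + m - k) ≤
      2 * factPow p (s + 1) * factPow p (s + m + 2) := by
    have hle : ∀ k ∈ Ico (s + 1) (s + m + 2),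
        factPow p k * factPow p (2 * s + 2 + m - k) ≤
          factPow p (s + 1) * factPow p (s + m + 1) := by
      intro k hk
      rw [mem_Ico] at hk
      have := factPow_mul_factPow_le p (s + 1) (k - (s + 1)) (s + m + 1 - k)
      rwa [show s + 1 + (k - (s + 1)) = k by omega,
        show s + 1 + (s + m + 1 - k) = 2 * s + 2 + m - k by omega,
        show k + (s + m + 1 - k) = s + m + 1 by omega] at this
    refine (sum_le_card_nsmul _ _ _ hle).trans ?_
    rw [Nat.card_Ico, nsmul_eq_mul, show s + m + 2 - (s + 1) = m + 1 by omega]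
    have h1 := mul_factPow_le hp (s + m + 1)
    have h2 := factPow_pos p (s + 1)
    have h3 := factPow_pos p (s + m + 1)
    have h4 : ((m + 1 : ℕ) : ℝ) ≤ ((s + m + 1 : ℕ) : ℝ) + 1 := by
      push_cast; linarith [s.cast_nonneg (α := ℝ)]
    calc ((m + 1 : ℕ) : ℝ) * (factPow p (s + 1) * factPow p (s + m + 1))
        ≤ (((s + m + 1 : ℕ) : ℝ) + 1) * (factPow p (s + 1) * factPow p (s + m + 1)) := by gcongr
      _ = factPow p (s + 1) * ((((s + m + 1 : ℕ) : ℝ) + 1) * factPow p (s + m + 1)) := by ring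
      _ ≤ factPow p (s + 1) * factPow p (s + m + 2) := by gcongr
      _ ≤ 2 * factPow p (s + 1) * factPow p (s + m + 2) := by
        nlinarith [mul_pos h2 (factPow_pos p (s + m + 2))]
  nlinarith [hmid]

lemma sum_antidiagonal_split (g : ℕ → ℕ → ℝ) {n r : ℕ} (hn : 2 * r + 2 ≤ n) :
    ∑ x ∈ antidiagonal n, g x.1 x.2 = ∑ j ∈ range (r + 1), g (n - j) j +
      ∑ k ∈ range (r + 1), g k (n - k) +
      ∑ k ∈ Ico (r + 1) (n + 1 - (r + 1)), g k (n - k) := by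
  rw [Finset.Nat.sum_antidiagonal_eq_sum_range_succ g, range_eq_Ico,
    ← sum_Ico_consecutive _ (Nat.zero_le (r + 1)) (show r + 1 ≤ n.succ by omega),
    ← sum_Ico_consecutive _ (show r + 1 ≤ n + 1 - (r + 1) by omega)
      (show n + 1 - (r + 1) ≤ n.succ by omega),
    sum_Ico_eq_sum_range _ (n + 1 - (r + 1)) n.succ,
    show n.succ - (n + 1 - (r + 1)) = r + 1 by omega, ← sum_range_reflect, ← range_eq_Ico]
  have : ∑ j ∈ range (r + 1), g (n + 1 - (r + 1) + (r + 1 - 1 - j))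
      (n - (n + 1 - (r + 1) + (r + 1 - 1 - j))) = ∑ j ∈ range (r + 1), g (n - j) j := by
    refine sum_congr rfl fun j hj => ?_
    rw [mem_range] at hj
    congr 1 <;> omega
  rw [this]; ring

/-- If `t` has an expansion with coefficients `c` in the scale `(n!)^p`, then the partial
convolution with a fixed sequence `a` with `a 0 = 0` has an expansion with coefficients the
convolution of `a` and `c`, to one order more. -/
lemma isBigO_conv_sub {p : ℕ} {t c a : ℕ → ℝ} (ha : a 0 = 0) (r : ℕ)
    (h : ∀ q ≤ r, (fun n => t n - ∑ k ∈ range q, c k * factPow p (n - k)) =O[atTop]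
      (fun n => factPow p (n - q))) :
    (fun n => ∑ j ∈ range (r + 1), a j * t (n - j) -
      ∑ s ∈ range (r + 1), (∑ x ∈ antidiagonal s, a x.1 * c x.2) * factPow p (n - s))
      =O[atTop] (fun n => factPow p (n - (r + 1))) := by
  have key : ∀ n, ∑ j ∈ range (r + 1), a j * t (n - j) -
      ∑ s ∈ range (r + 1), (∑ x ∈ antidiagonal s, a x.1 * c x.2) * factPow p (n - s) =
      ∑ j ∈ range (r + 1), a j *
        (t (n - j) - ∑ k ∈ range (r + 1 - j), c k * factPow p (n - j - k)) := by
    intro n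
    simp only [mul_sub, sum_sub_distrib]
    congr 1
    simp only [Finset.Nat.sum_antidiagonal_eq_sum_range_succ fun i j => a i * c j, sum_mul,
      mul_sum]
    rw [sum_sigma', sum_sigma']
    refine sum_bij' (fun x _ => ⟨x.2, x.1 - x.2⟩) (fun x _ => ⟨x.1 + x.2, x.1⟩) ?_ ?_ ?_ ?_ ?_
    · rintro ⟨i, j⟩ hx
      simp only [mem_sigma, mem_range] at hx ⊢; omega
    · rintro ⟨i, j⟩ hx
      simp only [mem_sigma, mem_range] at hx ⊢; omega
    · rintro ⟨i, j⟩ hx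
      simp only [mem_sigma, mem_range] at hx
      simp only [Sigma.mk.injEq, heq_eq_eq, and_true]; omega
    · rintro ⟨i, j⟩ hx
      simp
    · rintro ⟨i, j⟩ hx
      simp only [mem_sigma, mem_range] at hx
      simp only [mul_assoc]
      rw [show n - j - (i - j) = n - i by omega]
  simp only [key]
  refine IsBigO.fun_sum fun j hj => ?_
  rw [mem_range] at hj
  -- `a 0 = 0` removes `j = 0`, the only index needing order `r + 1`. For `j ≥ 1`, order `r + 1 - j`
  -- shifted by `j` yields an error at `n - (r + 1)`.
  rcases Nat.eq_zero_or_pos j with rfl | hj0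
  · simp only [ha, zero_mul]; exact isBigO_zero _ _
  · refine IsBigO.const_mul_left ?_ _
    have h1 := (h (r + 1 - j) (by omega)).comp_tendsto (tendsto_sub_atTop_nat j)
    refine h1.congr (fun _ => rfl) fun n => ?_
    simp only [Function.comp]
    congr 1; omega

/-- Expansion of a sequence `t` with `x T' = x F' / F`, where `F = ∑ (n!)^p x^n`: the coefficients
are those of `1 / F`. -/
theorem isBigO_sub_of_log_deriv {p : ℕ} (hp : 1 ≤ p) {t c : ℕ → ℝ}
    (ht0 : ∀ n, 0 ≤ t n) (ht : ∀ n, t n ≤ factPow p n)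
    (hlog : ∀ n : ℕ, (n : ℝ) * factPow p n =
      ∑ x ∈ antidiagonal n, (x.1 : ℝ) * t x.1 * factPow p x.2)
    (hinv : ∀ n : ℕ, ∑ x ∈ antidiagonal n, factPow p x.1 * c x.2 = if n = 0 then 1 else 0)
    (r : ℕ) :
    (fun n => t n - ∑ k ∈ range r, c k * factPow p (n - k)) =O[atTop]
      (fun n => factPow p (n - r)) := by
  induction r using Nat.strong_induction_on with
  | _ r ih =>
  rcases r with _ | r
  · simp only [range_zero, sum_empty, sub_zero, Nat.sub_zero]
    refine IsBigO.of_bound 1 (Eventually.of_forall fun n => ?_)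
    rw [Real.norm_of_nonneg (ht0 n), Real.norm_of_nonneg (factPow_pos _ _).le, one_mul]
    exact ht n
  have ih' : ∀ q ≤ r, (fun n => t n - ∑ k ∈ range q, c k * factPow p (n - k)) =O[atTop]
      (fun n => factPow p (n - q)) := fun q hq => ih q (by omega)
  -- This is `x F' * (1 / F) = x T'`. It makes the two end sums carrying the weights `j` and `k`
  -- cancel up to the error in `hX2`.
  have hconv : ∀ s : ℕ, ∑ x ∈ antidiagonal s, ((x.1 : ℝ) * factPow p x.1) * c x.2 = s * t s := by
    have e1 : PowerSeries.mk (fun n => (n : ℝ) * factPow p n) =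
        PowerSeries.mk (fun n => (n : ℝ) * t n) * PowerSeries.mk (factPow p) := by
      ext n; simp [PowerSeries.coeff_mul, hlog n]
    have e2 : PowerSeries.mk (factPow p) * PowerSeries.mk c = 1 := by
      ext n; simp [PowerSeries.coeff_mul, hinv n, PowerSeries.coeff_one]
    intro s
    have e3 : PowerSeries.mk (fun n => (n : ℝ) * factPow p n) * PowerSeries.mk c =
        PowerSeries.mk (fun n => (n : ℝ) * t n) := by
      rw [e1, mul_assoc, e2, mul_one]
    simpa [PowerSeries.coeff_mul] using congrArg (PowerSeries.coeff s) e3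
  have hX1 := isBigO_conv_sub (a := fun n => if n = 0 then 0 else factPow p n) (by simp) r ih'
  have hX2 := isBigO_conv_sub (a := fun n => (n : ℝ) * factPow p n) (by simp) r ih'
  have hmid : (fun n : ℕ => ((n : ℝ))⁻¹ * ∑ k ∈ Ico (r + 1) (n + 1 - (r + 1)),
      (k : ℝ) * t k * factPow p (n - k)) =O[atTop] (fun n => factPow p (n - (r + 1))) := by
    refine IsBigO.trans (IsBigO.of_bound 1 ?_) (isBigO_sum_Ico_factPow hp (r + 1))
    filter_upwards [eventually_gt_atTop 0] with n hn
    have hn' : (0 : ℝ) < n := by exact_mod_cast hn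
    have hnn : ∀ k, 0 ≤ factPow p k := fun k => (factPow_pos p k).le
    rw [Real.norm_of_nonneg (mul_nonneg (by positivity) (sum_nonneg fun k _ =>
        mul_nonneg (mul_nonneg k.cast_nonneg (ht0 k)) (hnn _))),
      Real.norm_of_nonneg (sum_nonneg fun k _ => mul_nonneg (hnn _) (hnn _)), one_mul, mul_sum]
    refine sum_le_sum fun k hk => ?_
    rw [mem_Ico] at hk
    have hk' : (n : ℝ)⁻¹ * k ≤ 1 := by
      rw [inv_mul_le_one₀ hn']
      exact_mod_cast (by omega : k ≤ n)
    calc (n : ℝ)⁻¹ * (k * t k * factPow p (n - k))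
        = ((n : ℝ)⁻¹ * k) * t k * factPow p (n - k) := by ring
      _ ≤ 1 * factPow p k * factPow p (n - k) := by
        gcongr
        · exact hnn _
        · exact ht0 _
        · exact ht k
      _ = _ := by rw [one_mul]
  have hX2' : (fun n : ℕ => ((n : ℝ))⁻¹ * (∑ j ∈ range (r + 1), (j : ℝ) * factPow p j * t (n - j) -
      ∑ s ∈ range (r + 1), (∑ x ∈ antidiagonal s, (x.1 : ℝ) * factPow p x.1 * c x.2) *
        factPow p (n - s))) =O[atTop] (fun n => factPow p (n - (r + 1))) := by
    refine IsBigO.trans (IsBigO.of_bound 1 ?_) hX2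
    filter_upwards [eventually_gt_atTop 0] with n hn
    rw [norm_mul]
    gcongr
    rw [norm_inv, Real.norm_natCast]
    exact inv_le_one_of_one_le₀ (by exact_mod_cast hn)
  -- Split `hlog` into its two ends and its middle, write `n - j` as `n` minus `j`, divide by `n`
  -- and solve for `t n`: the remainder is exactly this combination of three errors.
  refine ((hX2'.sub hX1).sub hmid).congr' ?_ EventuallyEq.rfl
  filter_upwards [eventually_ge_atTop (2 * r + 2)] with n hn
  have hn' : (n : ℝ) ≠ 0 := by
    have : n ≠ 0 := by omega
    exact_mod_cast this
  have hc : ∀ s, ∑ x ∈ antidiagonal s, (if x.1 = 0 then 0 else factPow p x.1) * c x.2 =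
      (if s = 0 then 1 else 0) - c s := by
    intro s
    rw [← hinv s, Finset.Nat.sum_antidiagonal_eq_sum_range_succ_mk,
      Finset.Nat.sum_antidiagonal_eq_sum_range_succ_mk, sum_range_succ', sum_range_succ']
    simp [factPow_zero]
  have hmain := hlog n
  rw [sum_antidiagonal_split (fun k l => (k : ℝ) * t k * factPow p l) hn] at hmain
  have h1 : ∑ j ∈ range (r + 1), ((n - j : ℕ) : ℝ) * t (n - j) * factPow p j =
      n * ∑ j ∈ range (r + 1), factPow p j * t (n - j) -
        ∑ j ∈ range (r + 1), (j : ℝ) * factPow p j * t (n - j) := by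
    rw [mul_sum, ← sum_sub_distrib]
    refine sum_congr rfl fun j hj => ?_
    rw [mem_range] at hj
    rw [Nat.cast_sub (by omega)]; ring
  have h2 : ∑ j ∈ range (r + 1), (if j = 0 then 0 else factPow p j) * t (n - j) =
      ∑ j ∈ range (r + 1), factPow p j * t (n - j) - t n := by
    rw [sum_range_succ', sum_range_succ']
    simp [factPow_zero]
  have h3 : ∑ s ∈ range (r + 1), (if s = 0 then 1 else 0) * factPow p (n - s) = factPow p n := by
    rw [sum_range_succ']
    simp
  rw [h1] at hmain
  simp only [hc, hconv, sub_mul, sum_sub_distrib, h2, h3]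
  field_simp
  linarith

end Expansion

open Equiv
open scoped Pointwise

/-! ### Tuples of permutations preserving a subset, and orbits -/

section Glue

variable {ι α β γ : Type*}

/-- The tuple of permutations of `α ≃ β ⊕ γ` given by tuples of permutations of `β` and `γ`. -/
def glue (e : β ⊕ γ ≃ α) (τ : ι → Perm β) (ρ : ι → Perm γ) : ι → Perm α :=
  fun i => e.permCongr (Perm.sumCongr (τ i) (ρ i))

@[simp]
lemma glue_apply_inl (e : β ⊕ γ ≃ α) (τ : ι → Perm β) (ρ : ι → Perm γ) (i : ι) (b : β) :
    glue e τ ρ i (e (Sum.inl b)) = e (Sum.inl (τ i b)) := by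
  simp [glue, Equiv.permCongr_apply]

lemma glue_injective (e : β ⊕ γ ≃ α) :
    Function.Injective fun x : (ι → Perm β) × (ι → Perm γ) => glue e x.1 x.2 := by
  rintro ⟨τ, ρ⟩ ⟨τ', ρ'⟩ h
  have key : ∀ i, (τ i, ρ i) = (τ' i, ρ' i) := fun i =>
    Perm.sumCongrHom_injective (e.permCongr.injective (congrFun h i))
  refine Prod.ext (funext fun i => (Prod.ext_iff.1 (key i)).1) (funext fun i => ?_)
  exact (Prod.ext_iff.1 (key i)).2

lemma exists_glue_eq [Finite β] [Finite γ] (e : β ⊕ γ ≃ α) (σ : ι → Perm α)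
    (h : ∀ i b, ∃ b', σ i (e (Sum.inl b)) = e (Sum.inl b')) :
    ∃ τ ρ, glue e τ ρ = σ := by
  have key : ∀ i, ∃ x : Perm β × Perm γ, Perm.sumCongrHom β γ x = e.symm.permCongr (σ i) := by
    intro i
    refine MonoidHom.mem_range.1 (Perm.mem_sumCongrHom_range_of_perm_mapsTo_inl ?_)
    rintro _ ⟨b, rfl⟩
    obtain ⟨b', hb'⟩ := h i b
    exact ⟨b', by simp [Equiv.permCongr_apply, hb']⟩
  choose x hx using key
  refine ⟨fun i => (x i).1, fun i => (x i).2, funext fun i => ?_⟩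
  have h1 : Perm.sumCongr (x i).1 (x i).2 = e.symm.permCongr (σ i) := hx i
  ext a
  simp [glue, h1, Equiv.permCongr_apply]

/-- Common to both decompositions, by orbit and by first block: the restriction to the stable part
carries the condition, the restriction to the complement is free. -/
lemma card_eq_of_glue [Finite β] [Finite γ] (e : β ⊕ γ ≃ α)
    (P : (ι → Perm β) → Prop) (Q : (ι → Perm α) → Prop)
    (hQ : ∀ τ ρ, Q (glue e τ ρ) ↔ P τ)
    (hstab : ∀ σ, Q σ → ∀ i b, ∃ b', σ i (e (Sum.inl b)) = e (Sum.inl b')) :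
    Nat.card {σ // Q σ} = Nat.card {τ // P τ} * Nat.card (ι → Perm γ) := by
  rw [← Nat.card_prod]
  symm
  refine Nat.card_congr (Equiv.ofBijective
    (fun x => ⟨glue e x.1.1 x.2, (hQ _ _).2 x.1.2⟩) ⟨?_, ?_⟩)
  · rintro ⟨⟨τ, h⟩, ρ⟩ ⟨⟨τ', h'⟩, ρ'⟩ hx
    have := glue_injective e (a₁ := (τ, ρ)) (a₂ := (τ', ρ')) (congrArg Subtype.val hx)
    simp only [Prod.mk.injEq] at this
    simp [this]
  · rintro ⟨σ, hσ⟩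
    obtain ⟨τ, ρ, rfl⟩ := exists_glue_eq e σ (hstab σ hσ)
    exact ⟨⟨⟨τ, (hQ _ _).1 hσ⟩, ρ⟩, rfl⟩

/-- The smallest set containing `x` and stable under all the `σ i`. -/
def reach (σ : ι → Perm α) (x : α) : Set α :=
  {y | ∀ T : Set α, x ∈ T → (∀ i, Set.MapsTo (σ i) T T) → y ∈ T}

lemma mem_reach_self (σ : ι → Perm α) (x : α) : x ∈ reach σ x := fun _ hx _ => hx

lemma mapsTo_reach (σ : ι → Perm α) (x : α) (i : ι) :
    Set.MapsTo (σ i) (reach σ x) (reach σ x) :=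
  fun _ hy T hx hT => hT i (hy T hx hT)

lemma reach_subset {σ : ι → Perm α} {x : α} {T : Set α} (hx : x ∈ T)
    (hT : ∀ i, Set.MapsTo (σ i) T T) : reach σ x ⊆ T :=
  fun _ hy => hy T hx hT

lemma reach_glue (e : β ⊕ γ ≃ α) (τ : ι → Perm β) (ρ : ι → Perm γ) (b : β) :
    reach (glue e τ ρ) (e (Sum.inl b)) = (fun b => e (Sum.inl b)) '' reach τ b := by
  apply Set.Subset.antisymm
  · refine reach_subset ⟨b, mem_reach_self τ b, rfl⟩ fun i => ?_
    rintro _ ⟨y, hy, rfl⟩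
    exact ⟨τ i y, mapsTo_reach τ b i hy, by simp⟩
  · rintro _ ⟨y, hy, rfl⟩ T hb hT
    refine hy {z | e (Sum.inl z) ∈ T} hb fun i z hz => ?_
    have := hT i hz
    rwa [glue_apply_inl] at this

/-- Forward stability suffices, without inverses: on a finite set, a permutation mapping `T` into
`T` stabilizes `T`. -/
lemma isPretransitive_closure_iff [Finite α] (σ : ι → Perm α) (x : α) :
    MulAction.IsPretransitive (Subgroup.closure (Set.range σ)) α ↔ reach σ x = Set.univ := by
  constructor
  · intro h
    refine Set.eq_univ_of_forall fun y T hx hT => ?_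
    have hle : Subgroup.closure (Set.range σ) ≤ MulAction.stabilizer (Perm α) T := by
      rw [Subgroup.closure_le]
      rintro _ ⟨i, rfl⟩
      exact (MulAction.mem_stabilizer_set' T.toFinite).2 (hT i)
    obtain ⟨g, hg⟩ := MulAction.exists_smul_eq (Subgroup.closure (Set.range σ)) x y
    rw [← hg]
    exact (MulAction.mem_stabilizer_set.1 (hle g.2) x).2 hx
  · intro h
    rw [MulAction.isPretransitive_iff_orbit_eq_univ x, ← Set.univ_subset_iff, ← h]
    refine reach_subset (MulAction.mem_orbit_self x) fun i y hy => ?_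
    exact MulAction.mem_orbit_of_mem_orbit
      (⟨σ i, Subgroup.subset_closure ⟨i, rfl⟩⟩ : Subgroup.closure (Set.range σ)) hy

end Glue

/-! ### Counting transitive tuples and constellations -/

/-- The number of `m`-tuples of permutations of `Fin n` generating a transitive group. -/
noncomputable def numTransitive (m n : ℕ) : ℕ :=
  Nat.card {σ : Multiperm m n //
    MulAction.IsPretransitive (Subgroup.closure (Set.range σ)) (Fin n)}

lemma card_multiperm (m n : ℕ) : Nat.card (Multiperm m n) = n.factorial ^ m := by
  rw [Nat.card_fun, Nat.card_perm, Nat.card_fin, Nat.card_fin]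

lemma numTransitive_le (m n : ℕ) : numTransitive m n ≤ n.factorial ^ m := by
  rw [← card_multiperm]
  exact Nat.card_le_card_of_injective _ Subtype.val_injective

lemma card_reach_eq (m : ℕ) {n : ℕ} (S : Finset (Fin n)) (x : Fin n) (hx : x ∈ S) :
    Nat.card {σ : Multiperm m n // reach σ x = S} =
      numTransitive m S.card * (n - S.card).factorial ^ m := by
  have hc : (Sᶜ).card = n - S.card := by simp [Finset.card_compl]
  rw [← card_multiperm]
  have hr : Set.range (fun b => finSumEquivOfFinset rfl hc (Sum.inl b)) = (S : Set (Fin n)) := by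
    simp only [finSumEquivOfFinset_inl]
    exact Finset.range_orderEmbOfFin S rfl
  obtain ⟨b, rfl⟩ : x ∈ Set.range (fun b => finSumEquivOfFinset rfl hc (Sum.inl b)) := by
    rw [hr]; exact hx
  refine card_eq_of_glue (finSumEquivOfFinset rfl hc) _ _ (fun τ ρ => ?_) fun σ hσ i y => ?_
  · rw [isPretransitive_closure_iff τ b, reach_glue, ← hr, ← Set.image_univ]
    exact Set.image_eq_image ((finSumEquivOfFinset rfl hc).injective.comp Sum.inl_injective)
  · have h1 := mapsTo_reach σ (finSumEquivOfFinset rfl hc (Sum.inl b)) i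
    rw [hσ, ← hr] at h1
    obtain ⟨b', hb'⟩ := h1 ⟨y, rfl⟩
    exact ⟨b', hb'.symm⟩

/-- Double count of tuples with a marked point `x`, sorted by the orbit `S` of `x`: there are
`n.choose k` sets of size `k`, each with `k` choices of `x`. -/
lemma mul_factorial_pow_eq_sum (m n : ℕ) : n * n.factorial ^ m =
    ∑ k ∈ Finset.range (n + 1),
      n.choose k * (k * (numTransitive m k * (n - k).factorial ^ m)) := by
  classical
  have h1 : ∀ x : Fin n, n.factorial ^ m = ∑ S : Finset (Fin n),
      if x ∈ S then numTransitive m S.card * (n - S.card).factorial ^ m else 0 := by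
    intro x
    rw [← card_multiperm, ← Nat.card_congr (Equiv.sigmaFiberEquiv
      (fun σ : Multiperm m n => (reach σ x).toFinset)), Nat.card_sigma]
    refine Finset.sum_congr rfl fun S _ => ?_
    split_ifs with hx
    · rw [← card_reach_eq m S x hx]
      refine Nat.card_congr (Equiv.subtypeEquivRight fun σ => ?_)
      rw [← Finset.coe_inj, Set.coe_toFinset]
    · rw [Nat.card_eq_zero]
      refine Or.inl ⟨fun σ => hx ?_⟩
      rw [← σ.2, Set.mem_toFinset]
      exact mem_reach_self _ _
  have h2 : n * n.factorial ^ m = ∑ x : Fin n, n.factorial ^ m := by simp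
  rw [h2, Finset.sum_congr rfl fun x _ => h1 x, Finset.sum_comm]
  simp only [Finset.sum_ite_mem, Finset.univ_inter, Finset.sum_const, smul_eq_mul]
  have h3 := Finset.sum_powerset_apply_card
    (fun k => k * (numTransitive m k * (n - k).factorial ^ m)) (x := (Finset.univ : Finset (Fin n)))
  simpa using h3

lemma log_deriv_numTransitive (p n : ℕ) : (n : ℝ) * factPow p n =
    ∑ x ∈ Finset.HasAntidiagonal.antidiagonal n,
      (x.1 : ℝ) * ((numTransitive (p + 1) x.1 : ℝ) / x.1.factorial) * factPow p x.2 := by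
  have h := congrArg (Nat.cast (R := ℝ)) (mul_factorial_pow_eq_sum (p + 1) n)
  rw [Finset.Nat.sum_antidiagonal_eq_sum_range_succ_mk]
  have hn : (n.factorial : ℝ) ≠ 0 := by positivity
  apply mul_left_cancel₀ hn
  push_cast at h
  calc (n.factorial : ℝ) * (n * factPow p n) = n * (n.factorial : ℝ) ^ (p + 1) := by
        simp only [factPow]; ring
    _ = _ := h
    _ = _ := by
      rw [Finset.mul_sum]
      refine Finset.sum_congr rfl fun k hk => ?_
      rw [Finset.mem_range] at hk
      rw [Nat.cast_choose ℝ (by omega : k ≤ n)]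
      have h1 : (k.factorial : ℝ) ≠ 0 := by positivity
      have h2 : ((n - k).factorial : ℝ) ≠ 0 := by positivity
      simp only [factPow]
      field_simp
      ring

/-- A constellation is determined by all its permutations but one. -/
lemma numConstellations_succ (m n : ℕ) : numConstellations (m + 1) n = numTransitive m n := by
  have hcl : ∀ τ : Multiperm m n,
      Subgroup.closure (Set.range (Fin.cons (List.ofFn τ).prod⁻¹ τ : Multiperm (m + 1) n)) =
        Subgroup.closure (Set.range τ) := by
    intro τ
    rw [Fin.range_cons]
    refine le_antisymm ((Subgroup.closure_le _).2 (Set.insert_subset ?_ Subgroup.subset_closure))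
      (Subgroup.closure_mono (Set.subset_insert _ _))
    refine inv_mem (list_prod_mem fun g hg => ?_)
    rw [List.mem_ofFn] at hg
    exact Subgroup.subset_closure hg
  symm
  refine Nat.card_congr (Equiv.ofBijective
    (fun τ => ⟨Fin.cons (List.ofFn τ.1).prod⁻¹ τ.1, ⟨?_, ?_⟩⟩) ⟨?_, ?_⟩)
  · rw [hcl]; exact τ.2
  · simp [List.ofFn_succ]
  · intro τ τ' h
    have h1 := congrArg Subtype.val h
    exact Subtype.ext (funext fun i => by simpa using congrFun h1 i.succ)
  · rintro ⟨σ, hσ⟩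
    have h0 : σ 0 = (List.ofFn (Fin.tail σ)).prod⁻¹ := by
      have := hσ.prod_eq_one
      rw [List.ofFn_succ, List.prod_cons] at this
      exact eq_inv_of_mul_eq_one_left this
    have h1 : Fin.cons (List.ofFn (Fin.tail σ)).prod⁻¹ (Fin.tail σ) = σ := by
      rw [← h0]; exact Fin.cons_self_tail σ
    refine ⟨⟨Fin.tail σ, ?_⟩, Subtype.ext h1⟩
    rw [← hcl, h1]
    exact hσ.transitive

/-! ### Indecomposable multipermutations and the inverse series -/

lemma initialSegment_add_eq_image {k j : ℕ} (l : ℕ) (hj : j ≤ k) :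
    initialSegment (k + l) j =
      (fun b : Fin k => finSumFinEquiv (Sum.inl b : Fin k ⊕ Fin l)) '' initialSegment k j := by
  ext x
  simp only [initialSegment, Set.mem_ofPred_eq, Set.mem_image, finSumFinEquiv_apply_left]
  constructor
  · intro hx
    exact ⟨⟨x, by omega⟩, hx, rfl⟩
  · rintro ⟨b, hb, rfl⟩
    exact hb

lemma initialSegment_self (n : ℕ) : initialSegment n n = Set.univ :=
  Set.eq_univ_of_forall fun x => x.2

lemma glue_image_initialSegment {m k l j : ℕ} (hj : j ≤ k) (τ : Multiperm m k)
    (ρ : Multiperm m l) (i : Fin m) :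
    glue finSumFinEquiv τ ρ i '' initialSegment (k + l) j = initialSegment (k + l) j ↔
      τ i '' initialSegment k j = initialSegment k j := by
  rw [initialSegment_add_eq_image l hj, Set.image_image]
  simp only [glue_apply_inl]
  rw [← Set.image_image (fun b : Fin k => finSumFinEquiv (Sum.inl b : Fin k ⊕ Fin l))]
  exact Set.image_eq_image (finSumFinEquiv.injective.comp Sum.inl_injective)

/-- The multipermutations whose first nonempty stable initial segment is `[k]`. -/
def IsFirstBlock {m n : ℕ} (σ : Multiperm m n) (k : ℕ) : Prop :=
  (∀ i, σ i '' initialSegment n k = initialSegment n k) ∧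
    ¬ ∃ j : ℕ, 0 < j ∧ j < k ∧ ∀ i, σ i '' initialSegment n j = initialSegment n j

lemma card_isFirstBlock (m k l : ℕ) :
    Nat.card {σ : Multiperm m (k + l) // IsFirstBlock σ k} = imp m k * l.factorial ^ m := by
  rw [← card_multiperm]
  refine card_eq_of_glue finSumFinEquiv _ _ (fun τ ρ => ?_) fun σ hσ i b => ?_
  · unfold IsFirstBlock IsIndecomposable
    have h1 : ∀ i, glue finSumFinEquiv τ ρ i '' initialSegment (k + l) k =
        initialSegment (k + l) k := fun i => by
      rw [glue_image_initialSegment le_rfl, initialSegment_self,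
        Set.image_univ_of_surjective (τ i).surjective]
    rw [and_iff_right h1]
    refine not_congr (exists_congr fun j => and_congr_right fun _ => and_congr_right fun hj => ?_)
    exact forall_congr' fun i => glue_image_initialSegment hj.le τ ρ i
  · have h1 := hσ.1 i
    rw [initialSegment_add_eq_image l le_rfl, initialSegment_self, Set.image_univ] at h1
    obtain ⟨b', hb'⟩ : σ i (finSumFinEquiv (Sum.inl b)) ∈
        Set.range fun b : Fin k => finSumFinEquiv (Sum.inl b : Fin k ⊕ Fin l) := by
      rw [← h1]; exact ⟨_, ⟨b, rfl⟩, rfl⟩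
    exact ⟨b', hb'.symm⟩

lemma factorial_pow_eq_sum_imp (m : ℕ) {n : ℕ} (hn : 0 < n) :
    n.factorial ^ m = ∑ k ∈ Finset.range n, imp m (k + 1) * (n - (k + 1)).factorial ^ m := by
  classical
  have hex : ∀ σ : Multiperm m n, ∃ k, 0 < k ∧
      ∀ i, σ i '' initialSegment n k = initialSegment n k := fun σ =>
    ⟨n, hn, fun i => by
      rw [initialSegment_self, Set.image_univ_of_surjective (σ i).surjective]⟩
  have hle : ∀ σ : Multiperm m n, Nat.find (hex σ) ≤ n := fun σ =>
    Nat.find_min' (hex σ) ⟨hn, fun i => by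
      rw [initialSegment_self, Set.image_univ_of_surjective (σ i).surjective]⟩
  have hpos : ∀ σ : Multiperm m n, 0 < Nat.find (hex σ) := fun σ => (Nat.find_spec (hex σ)).1
  -- The first block has size between `1` and `n`, so its size minus one indexes the fibres.
  let f : Multiperm m n → Fin n := fun σ =>
    ⟨Nat.find (hex σ) - 1, by have := hle σ; have := hpos σ; omega⟩
  rw [← card_multiperm, ← Nat.card_congr (Equiv.sigmaFiberEquiv f), Nat.card_sigma,
    Finset.sum_range fun k => imp m (k + 1) * (n - (k + 1)).factorial ^ m]
  refine Finset.sum_congr rfl fun k _ => ?_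
  obtain ⟨l, hl⟩ : ∃ l, n = (k + 1 : ℕ) + l := ⟨n - (k + 1), by omega⟩
  have h1 : Nat.card {σ : Multiperm m n // IsFirstBlock σ (k + 1)} =
      imp m (k + 1) * (n - (k + 1)).factorial ^ m := by
    generalize (k : ℕ) = k' at hl
    subst hl
    rw [card_isFirstBlock, Nat.add_sub_cancel_left]
  rw [← h1]
  refine Nat.card_congr (Equiv.subtypeEquivRight fun σ => ?_)
  have h2 : f σ = k ↔ Nat.find (hex σ) = k + 1 := by
    rw [Fin.ext_iff]
    have := hpos σ
    change Nat.find (hex σ) - 1 = k ↔ _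
    omega
  rw [h2, Nat.find_eq_iff, IsFirstBlock]
  constructor
  · rintro ⟨⟨-, h3⟩, h4⟩
    exact ⟨h3, fun ⟨j, hj0, hj, h⟩ => h4 j hj ⟨hj0, h⟩⟩
  · rintro ⟨h3, h4⟩
    exact ⟨⟨Nat.succ_pos _, h3⟩, fun j hj h => h4 ⟨j, h.1, hj, h.2⟩⟩

/-- The cyclic rotation moves `k - 1` out of `[k]`. Positivity ensures that no term of the expansion
vanishes identically, so each can serve as an error scale. -/
lemma imp_pos {m n : ℕ} (hm : 0 < m) (hn : 0 < n) : 0 < imp m n := by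
  obtain ⟨n, rfl⟩ : ∃ N, n = N + 1 := ⟨n - 1, by omega⟩
  refine Nat.card_pos_iff.2 ⟨⟨⟨fun _ => finRotate (n + 1), ?_⟩⟩, inferInstance⟩
  rintro ⟨k, hk0, hk, h⟩
  have h1 : finRotate (n + 1) ⟨k - 1, by omega⟩ ∈ initialSegment (n + 1) k := by
    rw [← h ⟨0, hm⟩]
    refine ⟨_, ?_, rfl⟩
    change k - 1 < k
    omega
  rw [finRotate_of_lt (by omega)] at h1
  change k - 1 + 1 < k at h1
  omega

/-- The coefficients of the series `1 - ∑_{k ≥ 1} imp_k x^k`. -/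
noncomputable def invCoeff (p k : ℕ) : ℝ := if k = 0 then 1 else -(imp p k : ℝ)

lemma sum_factPow_mul_invCoeff (p n : ℕ) :
    ∑ x ∈ Finset.HasAntidiagonal.antidiagonal n, factPow p x.1 * invCoeff p x.2 =
      if n = 0 then 1 else 0 := by
  rcases Nat.eq_zero_or_pos n with rfl | hn
  · simp [factPow_zero, invCoeff]
  · rw [if_neg hn.ne', ← Finset.Nat.sum_antidiagonal_swap]
    simp only [Prod.fst_swap, Prod.snd_swap]
    rw [Finset.Nat.sum_antidiagonal_eq_sum_range_succ_mk, Finset.sum_range_succ']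
    have := congrArg (Nat.cast (R := ℝ)) (factorial_pow_eq_sum_imp p hn)
    push_cast at this
    simp only [factPow, invCoeff, Nat.sub_zero, this, if_true, mul_one, Nat.succ_ne_zero, if_false]
    rw [← Finset.sum_add_distrib]
    exact Finset.sum_eq_zero fun k _ => by ring

/-! ### Irreducible tuples of linear orders -/

section LinearOrders

/-- The order on `α` transported from a linear order along a bijection. -/
abbrev pullbackOrder {α : Type*} {n : ℕ} (s : α ≃ Fin n) : LinearOrder α :=
  LinearOrder.lift' s s.injective

lemma pullbackOrder_lt_iff {α : Type*} {n : ℕ} (s : α ≃ Fin n) (a b : α) :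
    (pullbackOrder s).lt a b ↔ s a < s b := Iff.rfl

lemma pullbackOrder_bijective {α : Type*} {n : ℕ} [Fintype α] (hα : Fintype.card α = n) :
    Function.Bijective (pullbackOrder : α ≃ Fin n → LinearOrder α) := by
  constructor
  · intro s t h
    have hle : ∀ a b, s a ≤ s b ↔ t a ≤ t b := fun a b => by
      change (pullbackOrder s).le a b ↔ (pullbackOrder t).le a b
      rw [h]
    let g : Fin n ≃o Fin n := ⟨s.symm.trans t, fun {a b} => by simp [← hle]⟩
    have hg : g = OrderIso.refl _ := Subsingleton.elim _ _
    ext a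
    have := congrArg (fun u : Fin n ≃o Fin n => u (s a)) hg
    simp only [g, OrderIso.refl_apply] at this
    simpa using (congrArg Fin.val this).symm
  · intro L
    refine ⟨(Fintype.orderIsoFinOfCardEq α hα).symm.toEquiv, ?_⟩
    refine LinearOrder.ext_lt fun a b => ?_
    exact (Fintype.orderIsoFinOfCardEq α hα).symm.lt_iff_lt

lemma eq_initialSegment_ncard {n : ℕ} {D : Set (Fin n)} (hD : IsLowerSet D) :
    D = initialSegment n D.ncard := by
  have hlow : IsLowerSet (initialSegment n D.ncard) := 
    fun a b (hab : (b : ℕ) ≤ a) (ha : (a : ℕ) < _) => lt_of_le_of_lt hab ha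
  have hle : D.ncard ≤ n := by simpa using Set.ncard_le_card D
  have hcard : (initialSegment n D.ncard).ncard = D.ncard := by
    obtain ⟨l, hl⟩ := Nat.exists_eq_add_of_le hle
    generalize D.ncard = k at hl
    subst hl
    have hinj : Function.Injective fun b : Fin k => finSumFinEquiv (Sum.inl b : Fin k ⊕ Fin l) :=
      finSumFinEquiv.injective.comp Sum.inl_injective
    rw [initialSegment_add_eq_image l le_rfl, initialSegment_self,
      Set.ncard_image_of_injective _ hinj]
    simp
  rcases hD.total hlow with h | h
  · exact Set.eq_of_subset_of_ncard_le h hcard.le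
  · exact (Set.eq_of_subset_of_ncard_le h hcard.ge).symm

/-- A splitting `A, B` makes `A` an initial part of every order, so all the rankings send `A` to the
same `[k]`. The permutations `τ i` comparing the other rankings with `g` therefore fix `[k]`, and
conversely `A` is the preimage of `[k]` under `g`. -/
lemma isReducible_pullbackOrder_iff {p n : ℕ} (g : Perm (Fin n)) (τ : Multiperm p n) :
    IsReducible (fun i => pullbackOrder
      ((Fin.cons g fun i => τ i * g : Multiperm (p + 1) n) i)) ↔ ¬ IsIndecomposable τ := by
  rw [IsIndecomposable, not_not]
  constructor
  · rintro ⟨A, B, hA, hB, hAB, hdisj, h⟩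
    have hmem : ∀ x, x ∉ A → x ∈ B := fun x hx =>
      ((Set.ext_iff.1 hAB x).2 trivial).resolve_left hx
    have himg : ∀ i, (Fin.cons g fun i => τ i * g : Multiperm (p + 1) n) i '' A =
        initialSegment n A.ncard := by
      intro i
      set s := (Fin.cons g fun i => τ i * g : Multiperm (p + 1) n) i with hs
      rw [← Set.ncard_image_of_injective A s.injective]
      apply eq_initialSegment_ncard
      rintro _ b hb ⟨a, ha, rfl⟩
      refine ⟨s.symm b, ?_, by simp⟩
      by_contra hc
      have h1 : s a < s (s.symm b) := h a ha _ (hmem _ hc) i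
      rw [Equiv.apply_symm_apply] at h1
      exact absurd h1 (not_lt.2 hb)
    refine ⟨A.ncard, (Set.ncard_pos A.toFinite).2 hA, ?_, fun i => ?_⟩
    · have h1 : A ≠ Set.univ := by
        rintro rfl
        obtain ⟨b, hb⟩ := hB
        exact Set.disjoint_left.1 hdisj trivial hb
      simpa using Set.ncard_lt_card h1
    · have h0 := himg 0
      have h1 := himg i.succ
      simp only [Fin.cons_zero, Fin.cons_succ] at h0 h1
      rw [← h0, ← Set.image_comp, ← Perm.coe_mul, h1, h0]
  · rintro ⟨k, hk0, hk, h⟩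
    have hiff : ∀ i x, τ i x ∈ initialSegment n k ↔ x ∈ initialSegment n k := fun i x => by
      conv_lhs => rw [← h i]
      exact (τ i).injective.mem_set_image
    refine ⟨g ⁻¹' initialSegment n k, (g ⁻¹' initialSegment n k)ᶜ,
      ⟨g.symm ⟨0, by omega⟩, by simpa [initialSegment] using hk0⟩,
      ⟨g.symm ⟨k, hk⟩, by simp [initialSegment]⟩, Set.union_compl_self _, disjoint_compl_right,
      fun a ha b hb i => ?_⟩
    have hseg : ∀ x y : Fin n, x ∈ initialSegment n k → y ∉ initialSegment n k → x < y := by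
      intro x y hx hy
      simp only [initialSegment, Set.mem_ofPred_eq, not_lt] at hx hy
      exact Fin.lt_def.2 (lt_of_lt_of_le hx hy)
    rw [pullbackOrder_lt_iff]
    refine Fin.cases ?_ (fun i => ?_) i
    · exact hseg _ _ ha hb
    · exact hseg _ _ ((hiff i _).2 ha) fun hc => hb ((hiff i _).1 hc)

/-- The first order is arbitrary, which gives `n!`; the others, read relative to it, form an
indecomposable multipermutation. -/
lemma il_succ_eq (p n : ℕ) : il (p + 1) n = n.factorial * imp p n := by
  have hn : Nat.card (Perm (Fin n)) = n.factorial := by rw [Nat.card_perm, Nat.card_fin]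
  rw [← hn, imp, ← Nat.card_prod]
  symm
  have hred := fun (x : Perm (Fin n) × {σ : Multiperm p n // IsIndecomposable σ}) =>
    isReducible_pullbackOrder_iff x.1 x.2.1
  refine Nat.card_congr (Equiv.ofBijective
    (fun x => ⟨fun i => pullbackOrder ((Fin.cons x.1 fun i => x.2.1 i * x.1 :
      Multiperm (p + 1) n) i), fun h => (hred x).1 h x.2.2⟩) ⟨?_, ?_⟩)
  · rintro ⟨g, τ, hτ⟩ ⟨g', τ', hτ'⟩ h
    have h1 : ∀ i, (Fin.cons g fun i => τ i * g : Multiperm (p + 1) n) i =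
        (Fin.cons g' fun i => τ' i * g' : Multiperm (p + 1) n) i := fun i =>
      (pullbackOrder_bijective (by simp)).1 (congrFun (congrArg Subtype.val h) i)
    have h2 : g = g' := by simpa using h1 0
    subst h2
    have h3 : τ = τ' := funext fun i => by simpa using h1 i.succ
    subst h3
    rfl
  · rintro ⟨L, hL⟩
    choose s hs using fun i =>
      (pullbackOrder_bijective (n := n) (by simp)).2 (L i)
    have hcons : (Fin.cons (s 0) fun i => (s i.succ * (s 0)⁻¹) * s 0 : Multiperm (p + 1) n) = s := by
      funext i
      refine Fin.cases ?_ (fun i => ?_) i <;> simp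
    have hL' : L = fun i => pullbackOrder ((Fin.cons (s 0) fun i => (s i.succ * (s 0)⁻¹) * s 0 :
        Multiperm (p + 1) n) i) := by
      funext i; rw [hcons, hs]
    refine ⟨⟨s 0, fun i => s i.succ * (s 0)⁻¹, ?_⟩, Subtype.ext hL'.symm⟩
    by_contra hc
    rw [hL'] at hL
    exact hL ((isReducible_pullbackOrder_iff _ _).2 hc)

end LinearOrders

/-! ### Assembling the expansions -/

lemma expansionTerm_imp_eq (p : ℕ) {k n : ℕ} (hk : k ≤ n) :
    expansionTerm (p + 2) (fun k => (imp p k : ℝ)) k n =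
      n.factorial * (invCoeff p k * factPow p (n - k)) := by
  have h1 : (n.factorial : ℝ) = (n - k).factorial * n.descFactorial k := by
    exact_mod_cast (Nat.factorial_mul_descFactorial hk).symm
  have h2 : (n.descFactorial k : ℝ) ≠ 0 := by
    have := (Nat.descFactorial_eq_zero_iff_lt (n := n) (k := k)).not.2 (by omega)
    exact_mod_cast this
  simp only [expansionTerm, invCoeff, factPow]
  split_ifs with h
  · subst h
    simp [pow_succ']
  · simp only [show p + 2 - 1 = p + 1 by omega, Nat.add_sub_cancel]
    have h3 : (n.factorial : ℝ) ^ (p + 1) =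
        n.factorial * (((n - k).factorial : ℝ) ^ p * (n.descFactorial k : ℝ) ^ p) := by
      rw [← mul_pow, ← h1, pow_succ']
    rw [h3]
    field_simp

lemma invCoeff_ne_zero {p : ℕ} (hp : 1 ≤ p) (k : ℕ) : invCoeff p k ≠ 0 := by
  unfold invCoeff
  split_ifs with h
  · exact one_ne_zero
  · have := imp_pos (m := p) (n := k) hp (Nat.pos_of_ne_zero h)
    exact neg_ne_zero.2 (by exact_mod_cast this.ne')

lemma factPow_sub_succ_isLittleO {p : ℕ} (hp : 1 ≤ p) (k : ℕ) :
    (fun n => factPow p (n - (k + 1))) =o[atTop] (fun n => factPow p (n - k)) := by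
  have h : (fun n => factPow p n) =o[atTop] (fun n => factPow p (n + 1)) := by
    refine isLittleO_of_tendsto (fun n hn => absurd hn (factPow_pos _ _).ne') ?_
    refine squeeze_zero (fun n => (div_pos (factPow_pos _ _) (factPow_pos _ _)).le) (fun n => ?_)
      tendsto_one_div_add_atTop_nhds_zero_nat
    rw [div_le_div_iff₀ (factPow_pos _ _) (by positivity), one_mul, mul_comm]
    exact mul_factPow_le hp n
  refine (h.comp_tendsto (tendsto_sub_atTop_nat (k + 1))).congr' EventuallyEq.rfl ?_
  filter_upwards [eventually_ge_atTop (k + 1)] with n hn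
  simp only [Function.comp]
  congr 1; omega

theorem hasAsymptoticExpansion_imp {p : ℕ} (hp : 1 ≤ p) :
    HasAsymptoticExpansion (fun n => (numConstellations (p + 2) n : ℝ)) 0
      (expansionTerm (p + 2) fun k => (imp p k : ℝ)) := by
  have hterm : ∀ k, (expansionTerm (p + 2) fun k => (imp p k : ℝ)) k =ᶠ[atTop]
      fun n => (n.factorial : ℝ) * (invCoeff p k * factPow p (n - k)) := fun k => by
    filter_upwards [eventually_ge_atTop k] with n hn using expansionTerm_imp_eq p hn
  constructor
  · intro r _
    have h := isBigO_sub_of_log_deriv hp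
      (t := fun n => (numTransitive (p + 1) n : ℝ) / n.factorial) (c := invCoeff p)
      (fun n => by positivity)
      (fun n => by
        rw [div_le_iff₀ (by positivity), factPow, ← pow_succ]
        exact_mod_cast numTransitive_le (p + 1) n)
      (log_deriv_numTransitive p) (sum_factPow_mul_invCoeff p) (r + 1)
    -- The error scale must be the next term itself, coefficient included; this is where its
    -- nonvanishing is used.
    have h1 := (isBigO_refl (fun n : ℕ => (n.factorial : ℝ)) atTop).mul
      (h.trans ((isBigO_refl _ _).const_mul_right (invCoeff_ne_zero hp (r + 1))))
    refine h1.congr' ?_ (hterm (r + 1)).symm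
    filter_upwards [eventually_ge_atTop r] with n hn
    rw [numConstellations_succ, mul_sub, mul_div_cancel₀ _ (by positivity), Finset.mul_sum,
      ← Nat.range_succ_eq_Icc_zero]
    congr 1
    refine Finset.sum_congr rfl fun k hk => ?_
    rw [Finset.mem_range] at hk
    exact (expansionTerm_imp_eq p (by omega)).symm
  · intro k _
    refine IsLittleO.congr' ?_ (hterm (k + 1)).symm (hterm k).symm
    refine (isBigO_refl (fun n : ℕ => (n.factorial : ℝ)) atTop).mul_isLittleO ?_
    exact ((factPow_sub_succ_isLittleO hp k).const_mul_left _).trans_isBigO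
      ((isBigO_refl _ _).const_mul_right (invCoeff_ne_zero hp k))

end Constellation

theorem mainTheorem11 (d : ℕ) (hd : 3 ≤ d) :
    Constellation.HasAsymptoticExpansion
      (fun n => (Constellation.numConstellations d n : ℝ)) 0
      (Constellation.expansionTerm d (fun k => (Constellation.imp (d - 2) k : ℝ))) ∧
    Constellation.HasAsymptoticExpansion
      (fun n => (Constellation.numConstellations d n : ℝ)) 0
      (Constellation.expansionTerm d
        (fun k => (Constellation.il (d - 1) k : ℝ) / (k.factorial : ℝ))) := by
  obtain ⟨p, rfl⟩ : ∃ p, d = p + 2 := ⟨d - 2, by omega⟩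
  have hil : (fun k => (Constellation.il (p + 2 - 1) k : ℝ) / (k.factorial : ℝ)) =
      fun k => (Constellation.imp (p + 2 - 2) k : ℝ) := by
    funext k
    rw [show p + 2 - 1 = p + 1 by omega, Nat.add_sub_cancel, Constellation.il_succ_eq]
    push_cast
    field_simp
  rw [hil, and_self]
  exact Constellation.hasAsymptoticExpansion_imp (by omega)
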